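/- Conventions. Let $I$ be a finite set. A chamber system over $I$ is a set $\Delta$ of chambers together with an equivalence relation on $\Delta$ for each $i\in I$, whose classes are called $i$-panels; two distinct chambers in a common $i$-panel are called $i$-adjacent, and a gallery of type $(i_1,\dots,i_k)$ is a sequence $c_0,\dots,c_k$ with $c_{m-1}$ and $c_m$ being $i_m$-adjacent for each $m$. Write $\operatorname{dist}_\Delta$ for the length of a shortest gallery. A building of type $M=(m_{ij})_{i,j\in I}$, where $M$ is a Coxeter matrix with Coxeter group $W$, is a non-empty chamber system over $I$ in which every panel has at least two chambers, and which admits a map $\delta\colon\Delta\times\Delta\to W$ such that for every reduced word $f$ in the generators and all chambers $c,d$, $\delta(c,d)$ is the element represented by $f$ if and only if there is a gallery of type $f$ from $c$ to $d$. It is right-angled if $m_{ij}\in\{2,\infty\}$ for all $i\neq j$, and semiregular with parameters $(q_i)_{i\in I}$ if for each $i$ all $i$-panels have the same (possibly infinite) cardinality $q_i\ge 2$. Given sets $X_i$ with $|X_i|=q_i$, a legal colouring is a map $\lambda=(\lambda_i)_{i\in I}\colon\Delta\to\prod_{i\in I}X_i$ such that for each $i$-panel $\mathcal P$, $\lambda_i|_{\mathcal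 P}\colon\mathcal P\to X_i$ is a bijection and $\lambda_j|_{\mathcal P}$ is constant for every $j\ne i$. Proposition (implosion). Let $\Delta$ be a semiregular right-angled building of type $M$ over the finite set $I$, and let $\lambda$ be a legal colouring of $\Delta$ using colour sets $X_i$ ($i\in I$). For every $i\in I$ let $\equiv_i$ be an equivalence relation on $X_i$, write $[x]_i$ for the class of $x\in X_i$, and let $I'=\{i\in I\mid {\equiv_i}\text{ is not the universal relation}\}$. Let $M'=(m_{ij})_{i,j\in I'}$ be the type induced on $I'$. Then there exists a semiregular right-angled building of type $M'$ with parameters $q'_i=|X_i/{\equiv_i}|$ ($i\in I'$), together with a legal colouring using the colour sets $X_i/{\equiv_i}$ ($i\in I'$). Moreover, for every such building $\Delta'$ and every such legal colouring $\lambda'$ of $\Delta'$, there exists a surjective map $\tau\colon\Delta\to\Delta'$ such that $\lambda'_i(\tau(c))=[\lambda_i(c)]_i$ for all chambers $c\in\Delta$ and all $i\in I'$, and such that $\operatorname{dist}_{\Delta'}(\tau(c_1),\tau(c_2))\le\operatorname{dist}_\Delta(c_1,c_2)$ for all $c_1,c_2\in\Delta$. -/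

import Mathlib

universe u v w v'

/-- A chamber system over `I`: every `i : I` determines an equivalence relation on the set `C` of
chambers, whose classes are the `i`-panels. -/
structure ChamberSystem (I : Type*) (C : Type*) where
  /-- Being in the same `i`-panel. -/
  rel : I → Setoid C

namespace ChamberSystem

variable {I C : Type*}

/-- The `i`-panel containing the chamber `c`. -/
def panel (S : ChamberSystem I C) (i : I) (c : C) : Set C :=
  {d | (S.rel i) c d}

/-- `i`-adjacency: distinct chambers in a common `i`-panel. -/
def Adj (S : ChamberSystem I C) (i : I) (c d : C) : Prop :=
  (S.rel i) c d ∧ c ≠ d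

/-- `S.Joined f c d`: there is a gallery of type `f` from `c` to `d`. -/
inductive Joined (S : ChamberSystem I C) : List I → C → C → Prop
  | nil (c : C) : Joined S [] c c
  | cons {i : I} {f : List I} {c d e : C} :
      S.Adj i c d → Joined S f d e → Joined S (i :: f) c e

/-- The graph on the chambers whose edges are the pairs of adjacent chambers (of any type). -/
def graph (S : ChamberSystem I C) : SimpleGraph C where
  Adj c d := ∃ i, S.Adj i c d
  symm := ⟨fun _ _ ⟨i, h, hne⟩ => ⟨i, (S.rel i).symm h, hne.symm⟩⟩
  loopless := ⟨fun _ ⟨_, _, hne⟩ => hne rfl⟩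

/-- Gallery distance: the length of a shortest gallery. (Galleries between any two chambers exist
in a building.) -/
noncomputable def dist (S : ChamberSystem I C) (c d : C) : ℕ :=
  S.graph.dist c d

/-- A building of type `M`: a nonempty chamber system all of whose panels have at least two
chambers, and which has a Weyl distance function `δ` with values in the Coxeter group of `M`, i.e.
for every reduced word `f`, `δ c d` is the element represented by `f` if and only if `c` and `d`
are joined by a gallery of type `f`. -/
structure IsBuilding (S : ChamberSystem I C) (M : CoxeterMatrix I) : Prop where
  nonempty : Nonempty C
  exists_adj : ∀ (i : I) (c : C), ∃ d, S.Adj i c d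
  exists_weylDist : ∃ δ : C → C → M.Group,
    ∀ f : List I, M.toCoxeterSystem.IsReduced f →
      ∀ c d : C, δ c d = M.toCoxeterSystem.wordProd f ↔ S.Joined f c d

/-- All `i`-panels have the same, possibly infinite, cardinality `q i ≥ 2`. -/
def IsSemiregular {I : Type u} {C : Type v} (S : ChamberSystem I C)
    (q : I → Cardinal.{w}) : Prop :=
  ∀ i, 2 ≤ q i ∧
    ∀ c, Cardinal.lift.{w} (Cardinal.mk (S.panel i c)) = Cardinal.lift.{v} (q i)

/-- A legal colouring with colour sets `X i`: on every `i`-panel, the `i`-colour is a bijection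
onto `X i` and the other colours are constant. -/
structure IsLegalColouring (S : ChamberSystem I C) {X : I → Type*} (lam : C → ∀ i, X i) :
    Prop where
  bijOn : ∀ (i : I) (c : C), Set.BijOn (fun d => lam d i) (S.panel i c) Set.univ
  const : ∀ (i : I) (c : C), ∀ j, j ≠ i → ∀ d ∈ S.panel i c, lam d j = lam c j

end ChamberSystem

namespace CoxeterMatrix

variable {I : Type*}

/-- All off-diagonal entries are `2` or `∞` (the latter is encoded by `0`). -/
def IsRightAngled (M : CoxeterMatrix I) : Prop :=
  ∀ i j, i ≠ j → M i j = 2 ∨ M i j = 0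

/-- The Coxeter matrix (diagram) induced on the subset `{i | p i}` of the index set. -/
def induce (M : CoxeterMatrix I) (p : I → Prop) : CoxeterMatrix {i // p i} where
  M := M.M.submatrix Subtype.val Subtype.val
  isSymm := M.isSymm.submatrix _
  diagonal i := M.diagonal i.1
  off_diagonal i j h := M.off_diagonal i.1 j.1 fun e => h (Subtype.ext e)

end CoxeterMatrix

/-- A semiregular right-angled building of type `M` with parameters `q`. -/
structure ChamberSystem.IsSemiregularRAB {I : Type u} {C : Type v}
    (S : ChamberSystem I C) (M : CoxeterMatrix I) (q : I → Cardinal.{w}) : Prop where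
  rightAngled : M.IsRightAngled
  building : S.IsBuilding M
  semiregular : S.IsSemiregular q

/-!
In a right-angled Coxeter group two reduced words represent the same element only if they differ by
swaps of adjacent commuting letters: the group acts on the classes of words in which no two equal
letters can be brought together by such swaps, and the orbit of the empty word recovers the class of
every reduced word. It follows that a right-angled building is simply connected in the following
combinatorial sense. If in a covering of it commuting panels still close up to squares, then
galleries lift, the swaps lift with them, and the end of a lift depends only on the end of the
gallery; so the covering has a section through each of its chambers.

Let `T` be a legally coloured building over a subset of the types. Inside a panel a chamber is
determined by its colour, so a step in a panel of `S` dictates a step in `T`: the pairs of chambers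
of `S` and `T` with matching colours form a covering of `S`. The second component of a section is a
map from `S` to `T` with the prescribed effect on colours, which contracts the panels of the removed
types. This is the map `τ`. Applied with `T` equal to `S` (and the removed types forgotten), and
with colours replaced by representatives of their classes, it gives a retraction of `S`, whose fixed
chambers form the imploded building. Its Weyl distance is that of `S` followed by the retraction of
the Coxeter group onto the parabolic subgroup.
-/

theorem exists_walk_map_length_le {V V' : Type*} {G : SimpleGraph V} {H : SimpleGraph V'}
    {φ : V → V'} (hφ : ∀ a b, G.Adj a b → φ a = φ b ∨ H.Adj (φ a) (φ b)) {a b : V}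
    (γ : G.Walk a b) : ∃ γ' : H.Walk (φ a) (φ b), γ'.length ≤ γ.length := by
  induction γ with
  | nil => exact ⟨SimpleGraph.Walk.nil, le_rfl⟩
  | cons hadj γ ih =>
    obtain ⟨γ', hlen⟩ := ih
    rw [SimpleGraph.Walk.length_cons]
    obtain heq | hadj' := hφ _ _ hadj
    · exact ⟨γ'.copy heq.symm rfl, by rw [SimpleGraph.Walk.length_copy]; omega⟩
    · exact ⟨SimpleGraph.Walk.cons hadj' γ', by rw [SimpleGraph.Walk.length_cons]; omega⟩

theorem exists_rightInverse_apply_eq {α β : Type*} {f : α → β} (hf : Function.Surjective f)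
    (a : α) : ∃ g : β → α, Function.RightInverse g f ∧ g (f a) = a := by
  classical
  refine ⟨Function.update (Function.surjInv hf) (f a) a, fun b => ?_, Function.update_self _ _ _⟩
  obtain rfl | hb := eq_or_ne b (f a)
  · rw [Function.update_self]
  · rw [Function.update_of_ne hb, Function.surjInv_eq hf]

namespace RightAngledCoxeter

variable {I : Type*} {M : CoxeterMatrix I}

/-- Commutation equivalence: two words are related if they differ by a sequence of swaps of adjacent
letters `i`, `j` with `M i j = 2`. The constructors parallel those of `List.Perm`. -/
inductive CommEquiv (M : CoxeterMatrix I) : List I → List I → Prop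
  | nil : CommEquiv M [] []
  | cons (i : I) {f g : List I} : CommEquiv M f g → CommEquiv M (i :: f) (i :: g)
  | swap {i j : I} (f : List I) : M i j = 2 → CommEquiv M (i :: j :: f) (j :: i :: f)
  | trans {f g h : List I} : CommEquiv M f g → CommEquiv M g h → CommEquiv M f h

/-- The first occurrence of the letter `i` can be moved to the front of a word by swaps of adjacent
commuting letters. -/
def MovesToFront (M : CoxeterMatrix I) (i : I) : List I → Prop
  | [] => False
  | k :: f => k = i ∨ (M i k = 2 ∧ MovesToFront M i f)

/-- A word is commutation-reduced if no two equal letters of it can be brought together by swaps of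
adjacent commuting letters. -/
def IsCommReduced (M : CoxeterMatrix I) : List I → Prop
  | [] => True
  | i :: f => IsCommReduced M f ∧ ¬ MovesToFront M i f

theorem ne_of_eq_two {i j : I} (h : M i j = 2) : i ≠ j := by
  rintro rfl
  simp at h

theorem eq_two_symm {i j : I} (h : M i j = 2) : M j i = 2 := by
  rw [M.symmetric, h]

theorem movesToFront_cons_self {i : I} {f : List I} : MovesToFront M i (i :: f) :=
  Or.inl rfl

theorem movesToFront_cons_of_eq_two {i k : I} (h : M i k = 2) {f : List I} :
    MovesToFront M i (k :: f) ↔ MovesToFront M i f :=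
  ⟨fun hf => (hf.resolve_left (ne_of_eq_two h).symm).2, fun hf => Or.inr ⟨h, hf⟩⟩

namespace CommEquiv

theorem refl : ∀ f : List I, CommEquiv M f f
  | [] => nil
  | i :: f => (refl f).cons i

theorem symm {f g : List I} (h : CommEquiv M f g) : CommEquiv M g f := by
  induction h with
  | nil => exact nil
  | cons i _ ih => exact ih.cons i
  | swap f h => exact swap f (eq_two_symm h)
  | trans _ _ ih₁ ih₂ => exact ih₂.trans ih₁

theorem length_eq {f g : List I} (h : CommEquiv M f g) : f.length = g.length := by
  induction h with
  | nil => rfl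
  | cons i _ ih => simp only [List.length_cons, ih]
  | swap f _ => rfl
  | trans _ _ ih₁ ih₂ => exact ih₁.trans ih₂

theorem movesToFront_iff {f g : List I} (h : CommEquiv M f g) (i : I) :
    MovesToFront M i f ↔ MovesToFront M i g := by
  induction h with
  | nil => rfl
  | cons k _ ih => simp only [MovesToFront, ih]
  | @swap j k f h =>
    have h' := eq_two_symm h
    simp only [MovesToFront]
    constructor <;> rintro (rfl | ⟨h₁, rfl | ⟨h₂, h₃⟩⟩) <;> simp_all
  | trans _ _ ih₁ ih₂ => exact ih₁.trans ih₂

theorem erase [DecidableEq I] {f g : List I} (h : CommEquiv M f g) (i : I) :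
    CommEquiv M (f.erase i) (g.erase i) := by
  induction h with
  | nil => exact nil
  | @cons k f g h ih =>
    simp only [List.erase_cons]
    split_ifs
    exacts [h, ih.cons k]
  | @swap j k f h =>
    have hjk := ne_of_eq_two h
    simp only [List.erase_cons, beq_iff_eq]
    split_ifs with hj hk hk
    exacts [absurd (hj.trans hk.symm) hjk, refl _, refl _, swap _ h]
  | trans _ _ ih₁ ih₂ => exact ih₁.trans ih₂

end CommEquiv

section Toggle

variable [DecidableEq I]

theorem MovesToFront.commEquiv_cons_erase {i : I} : ∀ {f : List I}, MovesToFront M i f →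
    CommEquiv M (i :: f.erase i) f
  | k :: f, h => by
    by_cases hk : k = i
    · subst hk
      simpa only [List.erase_cons_head] using CommEquiv.refl _
    · obtain ⟨hik, hf⟩ := h.resolve_left hk
      rw [List.erase_cons_tail (by simpa using hk)]
      exact (CommEquiv.swap _ hik).trans (hf.commEquiv_cons_erase.cons k)

theorem movesToFront_erase_iff {i j : I} (hij : M i j = 2) : ∀ {f : List I},
    MovesToFront M i (f.erase j) ↔ MovesToFront M i f
  | [] => Iff.rfl
  | k :: f => by
    by_cases hk : k = j
    · subst hk
      rw [List.erase_cons_head, movesToFront_cons_of_eq_two hij]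
    · rw [List.erase_cons_tail (by simpa using hk)]
      simp only [MovesToFront, movesToFront_erase_iff hij]

theorem IsCommReduced.erase {i : I} : ∀ {f : List I}, IsCommReduced M f → MovesToFront M i f →
    IsCommReduced M (f.erase i) ∧ ¬ MovesToFront M i (f.erase i)
  | k :: f, hf, h => by
    by_cases hk : k = i
    · subst hk
      rwa [List.erase_cons_head]
    · obtain ⟨hik, hi⟩ := h.resolve_left hk
      obtain ⟨hred, hfront⟩ := hf.1.erase hi
      rw [List.erase_cons_tail (by simpa using hk)]
      exact ⟨⟨hred, mt (movesToFront_erase_iff (eq_two_symm hik)).1 hf.2⟩,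
        mt (movesToFront_cons_of_eq_two hik).1 hfront⟩

open Classical in
/-- Left multiplication by the generator `i` on words: cancel a letter `i` which can be moved to the
front, or else put a new letter `i` in front. -/
noncomputable def toggle (M : CoxeterMatrix I) (i : I) (f : List I) : List I :=
  if MovesToFront M i f then f.erase i else i :: f

theorem toggle_of_movesToFront {i : I} {f : List I} (h : MovesToFront M i f) :
    toggle M i f = f.erase i := if_pos h

theorem toggle_of_not_movesToFront {i : I} {f : List I} (h : ¬ MovesToFront M i f) :
    toggle M i f = i :: f := if_neg h

theorem isCommReduced_toggle {f : List I} (hf : IsCommReduced M f) (i : I) :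
    IsCommReduced M (toggle M i f) := by
  by_cases h : MovesToFront M i f
  · rw [toggle_of_movesToFront h]
    exact (hf.erase h).1
  · rw [toggle_of_not_movesToFront h]
    exact ⟨hf, h⟩

theorem CommEquiv.toggle_congr {f g : List I} (h : CommEquiv M f g) (i : I) :
    CommEquiv M (toggle M i f) (toggle M i g) := by
  by_cases hf : MovesToFront M i f
  · rw [toggle_of_movesToFront hf, toggle_of_movesToFront ((h.movesToFront_iff i).1 hf)]
    exact h.erase i
  · rw [toggle_of_not_movesToFront hf,
      toggle_of_not_movesToFront (mt (h.movesToFront_iff i).2 hf)]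
    exact h.cons i

theorem IsCommReduced.commEquiv_toggle_toggle {f : List I} (hf : IsCommReduced M f) (i : I) :
    CommEquiv M (toggle M i (toggle M i f)) f := by
  by_cases h : MovesToFront M i f
  · rw [toggle_of_movesToFront h, toggle_of_not_movesToFront (hf.erase h).2]
    exact h.commEquiv_cons_erase
  · rw [toggle_of_not_movesToFront h, toggle_of_movesToFront movesToFront_cons_self,
      List.erase_cons_head]
    exact CommEquiv.refl f

theorem movesToFront_toggle_iff {i j : I} (hij : M i j = 2) {f : List I} :
    MovesToFront M i (toggle M j f) ↔ MovesToFront M i f := by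
  by_cases h : MovesToFront M j f
  · rw [toggle_of_movesToFront h, movesToFront_erase_iff hij]
  · rw [toggle_of_not_movesToFront h, movesToFront_cons_of_eq_two hij]

theorem toggle_erase {i j : I} (hij : M i j = 2) (f : List I) :
    toggle M i (f.erase j) = (toggle M i f).erase j := by
  have hiff : MovesToFront M i (f.erase j) ↔ MovesToFront M i f := movesToFront_erase_iff hij
  by_cases h : MovesToFront M i f
  · rw [toggle_of_movesToFront h, toggle_of_movesToFront (hiff.2 h), List.erase_comm]
  · rw [toggle_of_not_movesToFront h, toggle_of_not_movesToFront (mt hiff.1 h),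
      List.erase_cons_tail (by simpa using ne_of_eq_two hij)]

theorem commEquiv_toggle_comm {i j : I} (hij : M i j = 2) (f : List I) :
    CommEquiv M (toggle M i (toggle M j f)) (toggle M j (toggle M i f)) := by
  have hji := eq_two_symm hij
  by_cases hj : MovesToFront M j f
  · rw [toggle_of_movesToFront hj, toggle_erase hij,
      toggle_of_movesToFront ((movesToFront_toggle_iff hji).2 hj)]
    exact CommEquiv.refl _
  by_cases hi : MovesToFront M i f
  · rw [toggle_of_movesToFront hi, toggle_erase hji,
      toggle_of_movesToFront ((movesToFront_toggle_iff hij).2 hi)]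
    exact CommEquiv.refl _
  · rw [toggle_of_not_movesToFront (mt (movesToFront_toggle_iff hij).1 hi),
      toggle_of_not_movesToFront (mt (movesToFront_toggle_iff hji).1 hj),
      toggle_of_not_movesToFront hi, toggle_of_not_movesToFront hj]
    exact CommEquiv.swap f hij

/-- Commutation equivalence on commutation-reduced words. Its classes are the normal forms of the
elements of a right-angled Coxeter group. -/
def commSetoid (M : CoxeterMatrix I) : Setoid {f : List I // IsCommReduced M f} where
  r f g := CommEquiv M f.1 g.1
  iseqv := ⟨fun f => CommEquiv.refl f.1, CommEquiv.symm, CommEquiv.trans⟩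

/-- The permutation of the classes of commutation-reduced words given by left multiplication by the
generator `i`. -/
noncomputable def togglePerm (M : CoxeterMatrix I) (i : I) :
    Equiv.Perm (Quotient (commSetoid M)) :=
  Function.Involutive.toPerm
    (Quotient.map (fun f => ⟨toggle M i f.1, isCommReduced_toggle f.2 i⟩)
      fun _ _ h => CommEquiv.toggle_congr h i) <| by
      rintro ⟨f⟩
      exact Quotient.sound (f.2.commEquiv_toggle_toggle i)

end Toggle

theorem isLiftable_of_isRightAngled (hM : M.IsRightAngled) {G : Type*} [Monoid G] {φ : I → G}
    (hsq : ∀ i, φ i * φ i = 1) (hcomm : ∀ i j, M i j = 2 → Commute (φ i) (φ j)) :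
    M.IsLiftable φ := by
  intro i j
  obtain rfl | hij := eq_or_ne i j
  · rw [hsq, one_pow]
  obtain h | h := hM i j hij
  · rw [h, (hcomm i j h).mul_pow, pow_two, pow_two, hsq, hsq, one_mul]
  · rw [h, pow_zero]

theorem isLiftable_togglePerm [DecidableEq I] (hM : M.IsRightAngled) :
    M.IsLiftable (togglePerm M) := by
  refine isLiftable_of_isRightAngled hM (fun i => ?_) fun i j hij => ?_ <;> ext ⟨f⟩
  · exact Quotient.sound (f.2.commEquiv_toggle_toggle i)
  · exact Quotient.sound (commEquiv_toggle_comm hij f.1)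

section CoxeterSystem

variable {W : Type*} [Group W] {cs : CoxeterSystem M W}

theorem commute_simple {i j : I} (h : M i j = 2) : Commute (cs.simple i) (cs.simple j) := by
  have hsq := cs.simple_mul_simple_pow i j
  rw [h, pow_two] at hsq
  rw [commute_iff_eq, eq_inv_of_mul_eq_one_left hsq, mul_inv_rev, cs.inv_simple, cs.inv_simple]

theorem CommEquiv.wordProd_eq {f g : List I} (h : CommEquiv M f g) :
    cs.wordProd f = cs.wordProd g := by
  induction h with
  | nil => rfl
  | cons i _ ih => rw [cs.wordProd_cons, cs.wordProd_cons, ih]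
  | swap f h => simp only [cs.wordProd_cons, ← mul_assoc, (commute_simple h).eq]
  | trans _ _ ih₁ ih₂ => exact ih₁.trans ih₂

theorem isReduced_of_cons {i : I} {f : List I} (h : cs.IsReduced (i :: f)) : cs.IsReduced f :=
  h.drop 1

theorem isReduced_singleton (i : I) : cs.IsReduced [i] := by
  rw [CoxeterSystem.IsReduced, cs.wordProd_singleton, cs.length_simple, List.length_singleton]

theorem isReduced_cons_or_exists_wordProd_cons_eq {f : List I} (hf : cs.IsReduced f) (i : I) :
    cs.IsReduced (i :: f) ∨
      ∃ g, cs.IsReduced (i :: g) ∧ cs.wordProd (i :: g) = cs.wordProd f := by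
  obtain hl | hl := cs.length_simple_mul (cs.wordProd f) i
  · left
    rw [CoxeterSystem.IsReduced, cs.wordProd_cons, hl, hf.eq, List.length_cons]
  · right
    obtain ⟨g, hg, hfg⟩ := cs.exists_isReduced (cs.simple i * cs.wordProd f)
    have hprod : cs.wordProd (i :: g) = cs.wordProd f := by
      rw [cs.wordProd_cons, ← hfg, cs.simple_mul_simple_cancel_left]
    refine ⟨g, ?_, hprod⟩
    rw [CoxeterSystem.IsReduced, hprod, ← hl, hfg, hg.eq, List.length_cons]

theorem isCommReduced_of_isReduced : ∀ {f : List I}, cs.IsReduced f → IsCommReduced M f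
  | [], _ => trivial
  | i :: f, h => by
    classical
    refine ⟨isCommReduced_of_isReduced (isReduced_of_cons h), fun hi => ?_⟩
    have hcancel : cs.wordProd (i :: f) = cs.wordProd (f.erase i) := by
      rw [cs.wordProd_cons, ← hi.commEquiv_cons_erase.wordProd_eq, cs.wordProd_cons,
        cs.simple_mul_simple_cancel_left]
    have hle := cs.length_wordProd_le (f.erase i)
    have hlen := hi.commEquiv_cons_erase.length_eq
    rw [← hcancel, h.eq, List.length_cons] at hle
    rw [List.length_cons] at hlen
    omega

theorem lift_togglePerm_wordProd_nil [DecidableEq I] (hM : M.IsRightAngled) :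
    ∀ {f : List I} (hf : IsCommReduced M f),
      cs.lift ⟨togglePerm M, isLiftable_togglePerm hM⟩ (cs.wordProd f)
        (Quotient.mk _ ⟨[], trivial⟩) = Quotient.mk _ ⟨f, hf⟩
  | [], _ => by rw [cs.wordProd_nil, map_one, Equiv.Perm.one_apply]
  | i :: f, hf => by
    rw [cs.wordProd_cons, map_mul, Equiv.Perm.mul_apply, lift_togglePerm_wordProd_nil hM hf.1,
      cs.lift_apply_simple]
    exact congrArg (Quotient.mk _) (Subtype.ext (toggle_of_not_movesToFront hf.2))

theorem commEquiv_of_wordProd_eq (hM : M.IsRightAngled) {f g : List I} (hf : cs.IsReduced f)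
    (hg : cs.IsReduced g) (h : cs.wordProd f = cs.wordProd g) : CommEquiv M f g := by
  classical
  have hclass := lift_togglePerm_wordProd_nil (cs := cs) hM (isCommReduced_of_isReduced hf)
  rw [h, lift_togglePerm_wordProd_nil hM (isCommReduced_of_isReduced hg)] at hclass
  exact CommEquiv.symm (Quotient.exact hclass)

theorem simple_injective (hM : M.IsRightAngled) : Function.Injective cs.simple := by
  intro i j hij
  rw [← cs.wordProd_singleton, ← cs.wordProd_singleton] at hij
  have hequiv := commEquiv_of_wordProd_eq hM (isReduced_singleton i) (isReduced_singleton j) hij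
  have hfront : MovesToFront M i [j] := (hequiv.movesToFront_iff i).1 movesToFront_cons_self
  exact (hfront.resolve_right And.right).symm

theorem isReduced_pair (hM : M.IsRightAngled) {i j : I} (hij : i ≠ j) : cs.IsReduced [i, j] := by
  refine (isReduced_cons_or_exists_wordProd_cons_eq (isReduced_singleton j) i).resolve_right ?_
  rintro ⟨g, hg, hprod⟩
  have hlen : [j].length = (i :: g).length := by rw [← hg.eq, hprod, (isReduced_singleton j).eq]
  obtain rfl := List.length_eq_zero_iff.1 (Nat.succ.inj hlen).symm
  rw [cs.wordProd_singleton, cs.wordProd_singleton] at hprod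
  exact hij (simple_injective hM hprod)

end CoxeterSystem

section Parabolic

variable {p : I → Prop}

theorem isRightAngled_induce (hM : M.IsRightAngled) (p : I → Prop) :
    (M.induce p).IsRightAngled :=
  fun i j hij => hM i.1 j.1 fun e => hij (Subtype.ext e)

/-- The homomorphism from the Coxeter group of the matrix induced on `{i // p i}` onto the standard
parabolic subgroup of these types. -/
def parabolicInclusion (M : CoxeterMatrix I) (p : I → Prop) : (M.induce p).Group →* M.Group :=
  (M.induce p).toCoxeterSystem.lift ⟨fun i => M.toCoxeterSystem.simple i.1,
    fun i j => M.toCoxeterSystem.simple_mul_simple_pow i.1 j.1⟩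

theorem parabolicInclusion_simple (i : {i // p i}) :
    parabolicInclusion M p ((M.induce p).toCoxeterSystem.simple i) =
      M.toCoxeterSystem.simple i.1 :=
  CoxeterSystem.lift_apply_simple _ _ i

open Classical in
/-- The retraction of a right-angled Coxeter group onto a standard parabolic subgroup which sends
the generators of the remaining types to `1`. -/
noncomputable def parabolicRetraction (hM : M.IsRightAngled) (p : I → Prop) :
    M.Group →* (M.induce p).Group :=
  M.toCoxeterSystem.lift
    ⟨fun i => if h : p i then (M.induce p).toCoxeterSystem.simple ⟨i, h⟩ else 1, by
      refine isLiftable_of_isRightAngled hM (fun i => ?_) fun i j hij => ?_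
      · split_ifs
        exacts [CoxeterSystem.simple_mul_simple_self _ _, one_mul 1]
      · by_cases hi : p i <;> by_cases hj : p j <;>
          simp only [hi, hj, dif_pos, dif_neg, not_false_iff, Commute.one_left, Commute.one_right]
        exact commute_simple (M := M.induce p) (i := ⟨i, hi⟩) (j := ⟨j, hj⟩) hij⟩

theorem parabolicRetraction_simple (hM : M.IsRightAngled) (i : {i // p i}) :
    parabolicRetraction hM p (M.toCoxeterSystem.simple i.1) =
      (M.induce p).toCoxeterSystem.simple i :=
  (CoxeterSystem.lift_apply_simple _ _ i.1).trans (dif_pos i.2)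

theorem parabolicRetraction_simple_of_not (hM : M.IsRightAngled) {i : I} (hi : ¬ p i) :
    parabolicRetraction hM p (M.toCoxeterSystem.simple i) = 1 :=
  (CoxeterSystem.lift_apply_simple _ _ i).trans (dif_neg hi)

theorem parabolicRetraction_parabolicInclusion (hM : M.IsRightAngled) (x : (M.induce p).Group) :
    parabolicRetraction hM p (parabolicInclusion M p x) = x := by
  have hcomp : (parabolicRetraction hM p).comp (parabolicInclusion M p) = MonoidHom.id _ := by
    refine (M.induce p).toCoxeterSystem.ext_simple fun i => ?_
    rw [MonoidHom.comp_apply, parabolicInclusion_simple, parabolicRetraction_simple,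
      MonoidHom.id_apply]
  exact DFunLike.congr_fun hcomp x

theorem wordProd_map_val (f : List {i // p i}) :
    M.toCoxeterSystem.wordProd (f.map Subtype.val) =
      parabolicInclusion M p ((M.induce p).toCoxeterSystem.wordProd f) := by
  induction f with
  | nil => simp
  | cons i f ih =>
    rw [List.map_cons, CoxeterSystem.wordProd_cons, CoxeterSystem.wordProd_cons, map_mul, ih,
      parabolicInclusion_simple]

theorem parabolicRetraction_wordProd_map_val (hM : M.IsRightAngled) (f : List {i // p i}) :
    parabolicRetraction hM p (M.toCoxeterSystem.wordProd (f.map Subtype.val)) =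
      (M.induce p).toCoxeterSystem.wordProd f := by
  rw [wordProd_map_val, parabolicRetraction_parabolicInclusion]

theorem length_parabolicRetraction_wordProd_le (hM : M.IsRightAngled) (f : List I) :
    (M.induce p).toCoxeterSystem.length
      (parabolicRetraction hM p (M.toCoxeterSystem.wordProd f)) ≤ f.length := by
  induction f with
  | nil => simp
  | cons i f ih =>
    rw [CoxeterSystem.wordProd_cons, map_mul, List.length_cons, add_comm]
    refine (CoxeterSystem.length_mul_le _ _ _).trans (add_le_add ?_ ih)
    by_cases hi : p i
    · rw [parabolicRetraction_simple hM ⟨i, hi⟩, CoxeterSystem.length_simple]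
    · rw [parabolicRetraction_simple_of_not hM hi, CoxeterSystem.length_one]
      exact zero_le_one

theorem isReduced_map_val (hM : M.IsRightAngled) {f : List {i // p i}}
    (hf : (M.induce p).toCoxeterSystem.IsReduced f) :
    M.toCoxeterSystem.IsReduced (f.map Subtype.val) := by
  refine le_antisymm (M.toCoxeterSystem.length_wordProd_le _) ?_
  obtain ⟨g, hg, hfg⟩ :=
    M.toCoxeterSystem.exists_isReduced (M.toCoxeterSystem.wordProd (f.map Subtype.val))
  have hle := length_parabolicRetraction_wordProd_le (p := p) hM g
  rwa [← hfg, parabolicRetraction_wordProd_map_val, hf.eq, ← hg.eq, ← hfg,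
    ← List.length_map (f := Subtype.val)] at hle

end Parabolic

end RightAngledCoxeter

namespace ChamberSystem

open RightAngledCoxeter

variable {I C : Type*} {S : ChamberSystem I C} {M : CoxeterMatrix I}

theorem Adj.symm {i : I} {c d : C} (h : S.Adj i c d) : S.Adj i d c :=
  ⟨(S.rel i).symm h.1, h.2.symm⟩

theorem Adj.trans {i : I} {c d e : C} (h : S.Adj i c d) (h' : S.Adj i d e) (hne : c ≠ e) :
    S.Adj i c e :=
  ⟨(S.rel i).trans h.1 h'.1, hne⟩

theorem Joined.reachable {f : List I} {c d : C} (h : S.Joined f c d) : S.graph.Reachable c d := by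
  induction h with
  | nil c => exact SimpleGraph.Reachable.refl c
  | cons h _ ih => exact (SimpleGraph.Adj.reachable (show S.graph.Adj _ _ from ⟨_, h⟩)).trans ih

/-- Panels of commuting types `i`, `j` (that is, `M i j = 2`) are interchangeable: a path through an
`i`-panel and then a `j`-panel can be replaced by one through a `j`-panel and then an `i`-panel. -/
def HasCommutingSquares (S : ChamberSystem I C) (M : CoxeterMatrix I) : Prop :=
  ∀ ⦃i j⦄, M i j = 2 → ∀ ⦃a b c⦄, S.rel i a b → S.rel j b c → ∃ b', S.rel j a b' ∧ S.rel i b' c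

/-- Panels of distinct types meet in at most one chamber. -/
def HasThinIntersections (S : ChamberSystem I C) : Prop :=
  ∀ ⦃i j⦄, i ≠ j → ∀ ⦃a b⦄, S.rel i a b → S.rel j a b → a = b

section Galleries

theorem Joined.of_commEquiv (hsq : S.HasCommutingSquares M) (hthin : S.HasThinIntersections)
    {f g : List I} (hfg : CommEquiv M f g) {c d : C} (h : S.Joined f c d) : S.Joined g c d := by
  induction hfg generalizing c with
  | nil => exact h
  | cons i _ ih =>
    obtain _ | ⟨hadj, h⟩ := h
    exact Joined.cons hadj (ih h)
  | swap f hij =>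
    obtain _ | ⟨⟨hi, hci⟩, _ | ⟨⟨hj, hcj⟩, h⟩⟩ := h
    obtain ⟨b, hj', hi'⟩ := hsq hij hi hj
    refine Joined.cons ⟨hj', ?_⟩ (Joined.cons ⟨hi', ?_⟩ h)
    · rintro rfl
      exact hcj (hthin (ne_of_eq_two hij) ((S.rel _).trans ((S.rel _).symm hi) hi') hj)
    · rintro rfl
      exact hci (hthin (ne_of_eq_two hij) hi ((S.rel _).trans hj' ((S.rel _).symm hj)))
  | trans _ _ ih₁ ih₂ => exact ih₂ (ih₁ h)

theorem Joined.exists_isReduced (hM : M.IsRightAngled) (hsq : S.HasCommutingSquares M)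
    (hthin : S.HasThinIntersections) {f : List I} {c d : C} (h : S.Joined f c d) :
    ∃ g, M.toCoxeterSystem.IsReduced g ∧ S.Joined g c d := by
  induction h with
  | nil c => exact ⟨[], by simp [CoxeterSystem.IsReduced], Joined.nil c⟩
  | @cons i _ c b d hadj _ ih =>
    obtain ⟨g, hg, hjoined⟩ := ih
    obtain hig | ⟨g', hig', hprod⟩ := isReduced_cons_or_exists_wordProd_cons_eq hg i
    · exact ⟨i :: g, hig, Joined.cons hadj hjoined⟩
    · have hjoined' := hjoined.of_commEquiv hsq hthin
        (commEquiv_of_wordProd_eq hM hg hig' hprod.symm)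
      obtain _ | @⟨_, _, _, b', _, hadj', htail⟩ := hjoined'
      obtain rfl | hne := eq_or_ne c b'
      · exact ⟨g', isReduced_of_cons hig', htail⟩
      · exact ⟨i :: g', hig', Joined.cons (hadj.trans hadj' hne) htail⟩

end Galleries

/-- `δ` is a Weyl distance function of type `M` on `S`. -/
def IsWeylDist (S : ChamberSystem I C) (M : CoxeterMatrix I) (δ : C → C → M.Group) : Prop :=
  ∀ f : List I, M.toCoxeterSystem.IsReduced f →
    ∀ c d : C, δ c d = M.toCoxeterSystem.wordProd f ↔ S.Joined f c d

namespace IsWeylDist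

variable {δ : C → C → M.Group} (hδ : S.IsWeylDist M δ)
include hδ

theorem exists_joined (c d : C) : ∃ f : List I, M.toCoxeterSystem.IsReduced f ∧
    δ c d = M.toCoxeterSystem.wordProd f ∧ S.Joined f c d := by
  obtain ⟨f, hf, h⟩ := M.toCoxeterSystem.exists_isReduced (δ c d)
  exact ⟨f, hf, h, (hδ f hf c d).1 h⟩

theorem reachable (c d : C) : S.graph.Reachable c d :=
  let ⟨_, _, _, h⟩ := hδ.exists_joined c d
  h.reachable

theorem self_eq_one (c : C) : δ c c = 1 := by
  rw [← M.toCoxeterSystem.wordProd_nil]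
  exact (hδ [] (by simp [CoxeterSystem.IsReduced]) c c).2 (Joined.nil c)

theorem eq_simple_of_adj {i : I} {c d : C} (h : S.Adj i c d) :
    δ c d = M.toCoxeterSystem.simple i := by
  rw [← M.toCoxeterSystem.wordProd_singleton]
  exact (hδ _ (isReduced_singleton i) c d).2 (Joined.cons h (Joined.nil d))

theorem eq_simple_mul_or_eq {i : I} {c d : C} (h : S.Adj i d c) (e : C) :
    δ d e = M.toCoxeterSystem.simple i * δ c e ∨ δ d e = δ c e := by
  obtain ⟨f, hf, hcf, hjoined⟩ := hδ.exists_joined c e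
  rw [hcf, ← CoxeterSystem.wordProd_cons]
  obtain hif | ⟨g, hig, hprod⟩ := isReduced_cons_or_exists_wordProd_cons_eq hf i
  · exact Or.inl ((hδ _ hif d e).2 (Joined.cons h hjoined))
  · obtain _ | @⟨_, _, _, b, _, hcb, hbe⟩ := (hδ _ hig c e).1 (hcf.trans hprod.symm)
    obtain rfl | hne := eq_or_ne d b
    · left
      rw [CoxeterSystem.wordProd_cons, ← hprod, CoxeterSystem.wordProd_cons,
        CoxeterSystem.simple_mul_simple_cancel_left]
      exact (hδ g (isReduced_of_cons hig) d e).2 hbe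
    · right
      rw [← hprod]
      exact (hδ _ hig d e).2 (Joined.cons (h.trans hcb hne) hbe)

theorem length_le {f : List I} {c d : C} (h : S.Joined f c d) :
    M.toCoxeterSystem.length (δ c d) ≤ f.length := by
  induction h with
  | nil c => rw [hδ.self_eq_one, CoxeterSystem.length_one, List.length_nil]
  | @cons i f c b d h _ ih =>
    rw [List.length_cons]
    obtain heq | heq := hδ.eq_simple_mul_or_eq h d <;> rw [heq]
    · have hle := M.toCoxeterSystem.length_mul_le (M.toCoxeterSystem.simple i) (δ b d)
      rw [CoxeterSystem.length_simple] at hle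
      omega
    · omega

theorem eq_of_joined {i : I} {f : List I} (hf : M.toCoxeterSystem.IsReduced (i :: f))
    {b b' d e : C} (hb : S.Adj i d b) (hb' : S.Adj i d b') (h : S.Joined f b e)
    (h' : S.Joined f b' e) : b = b' := by
  by_contra hne
  have hred := isReduced_of_cons hf
  have hif := (hδ _ hf b e).2 (Joined.cons (hb.symm.trans hb' hne) h')
  have hlen := hf.eq
  rw [← hif, (hδ f hred b e).2 h, hred.eq, List.length_cons] at hlen
  omega

theorem hasThinIntersections (hM : M.IsRightAngled) : S.HasThinIntersections := by
  intro i j hij a b hi hj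
  by_contra hne
  exact hij (simple_injective hM
    ((hδ.eq_simple_of_adj ⟨hi, hne⟩).symm.trans (hδ.eq_simple_of_adj ⟨hj, hne⟩)))

theorem hasCommutingSquares (hM : M.IsRightAngled) : S.HasCommutingSquares M := by
  intro i j hij a b c hi hj
  have hne := ne_of_eq_two hij
  obtain rfl | hab := eq_or_ne a b
  · exact ⟨c, hj, (S.rel i).refl c⟩
  obtain rfl | hbc := eq_or_ne b c
  · exact ⟨a, (S.rel j).refl a, hi⟩
  have hac := (hδ _ (isReduced_pair hM hne) a c).2
    (Joined.cons ⟨hi, hab⟩ (Joined.cons ⟨hj, hbc⟩ (Joined.nil c)))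
  rw [(CommEquiv.swap [] hij).wordProd_eq] at hac
  obtain _ | ⟨hj', _ | ⟨hi', _ | _⟩⟩ := (hδ _ (isReduced_pair hM hne.symm) a c).1 hac
  exact ⟨_, hj'.1, hi'.1⟩

theorem induction_on {P : C → Prop} {c₀ : C} (base : P c₀)
    (step : ∀ i c d, S.rel i c d → P c → P d) (c : C) : P c := by
  obtain ⟨f, -, -, hf⟩ := hδ.exists_joined c c₀
  induction hf with
  | nil c => exact base
  | cons h _ ih => exact step _ _ _ h.symm.1 (ih base)

end IsWeylDist

/-- A covering of chamber systems: a map which restricts to a bijection from each panel of `T` onto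
the panel of the same type around the image. -/
structure IsCovering {E : Type*} (T : ChamberSystem I E) (S : ChamberSystem I C) (π : E → C) :
    Prop where
  rel_map : ∀ {i a b}, T.rel i a b → S.rel i (π a) (π b)
  exists_lift : ∀ {i a d}, S.rel i (π a) d → ∃ b, T.rel i a b ∧ π b = d
  eq_of_map_eq : ∀ {i a b}, T.rel i a b → π a = π b → a = b

namespace IsCovering

variable {E : Type*} {T : ChamberSystem I E} {π : E → C}

theorem map_adj (hπ : IsCovering T S π) {i : I} {a b : E} (h : T.Adj i a b) :
    S.Adj i (π a) (π b) :=
  ⟨hπ.rel_map h.1, fun heq => h.2 (hπ.eq_of_map_eq h.1 heq)⟩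

theorem map_joined (hπ : IsCovering T S π) {f : List I} {a b : E} (h : T.Joined f a b) :
    S.Joined f (π a) (π b) := by
  induction h with
  | nil a => exact Joined.nil _
  | cons h _ ih => exact Joined.cons (hπ.map_adj h) ih

theorem hasThinIntersections (hπ : IsCovering T S π) (hS : S.HasThinIntersections) :
    T.HasThinIntersections :=
  fun _ _ hij _ _ hi hj => hπ.eq_of_map_eq hi (hS hij (hπ.rel_map hi) (hπ.rel_map hj))

theorem exists_joined_lift (hπ : IsCovering T S π) {f : List I} {c d : C} (h : S.Joined f c d)
    {e₀ : E} (he₀ : π e₀ = d) : ∃ e, π e = c ∧ T.Joined f e e₀ := by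
  induction h with
  | nil c => exact ⟨e₀, he₀, Joined.nil e₀⟩
  | cons h _ ih =>
    obtain ⟨e, rfl, he⟩ := ih he₀
    obtain ⟨b, hb, rfl⟩ := hπ.exists_lift h.symm.1
    exact ⟨b, rfl, Joined.cons ⟨(T.rel _).symm hb, ne_of_apply_ne π h.2⟩ he⟩

variable {δ : C → C → M.Group}

theorem eq_of_joined_isReduced (hπ : IsCovering T S π) (hδ : S.IsWeylDist M δ) {f : List I}
    (hf : M.toCoxeterSystem.IsReduced f) {a a' e : E} (h : T.Joined f a e) (h' : T.Joined f a' e)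
    (haa' : π a = π a') : a = a' := by
  induction h generalizing a' with
  | nil e => cases h'; rfl
  | @cons i f a b e hab hbe ih =>
    obtain _ | @⟨_, _, _, b', _, hab', hbe'⟩ := h'
    have hbb' : π b = π b' := hδ.eq_of_joined hf (hπ.map_adj hab) (haa' ▸ hπ.map_adj hab')
      (hπ.map_joined hbe) (hπ.map_joined hbe')
    obtain rfl := ih (isReduced_of_cons hf) hbe' hbb'
    exact hπ.eq_of_map_eq ((T.rel i).trans hab.1 ((T.rel i).symm hab'.1)) haa'

theorem eq_of_joined (hπ : IsCovering T S π) (hδ : S.IsWeylDist M δ) (hM : M.IsRightAngled)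
    (hsq : T.HasCommutingSquares M) {f g : List I} {a a' e : E} (h : T.Joined f a e)
    (h' : T.Joined g a' e) (haa' : π a = π a') : a = a' := by
  have hthin := hπ.hasThinIntersections (hδ.hasThinIntersections hM)
  obtain ⟨f', hf', hae⟩ := h.exists_isReduced hM hsq hthin
  obtain ⟨g', hg', ha'e⟩ := h'.exists_isReduced hM hsq hthin
  have hprod : M.toCoxeterSystem.wordProd f' = M.toCoxeterSystem.wordProd g' := by
    rw [← (hδ f' hf' _ _).2 (hπ.map_joined hae), haa', (hδ g' hg' _ _).2 (hπ.map_joined ha'e)]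
  have hfg := commEquiv_of_wordProd_eq hM hf' hg' hprod
  exact hπ.eq_of_joined_isReduced hδ hg' (hae.of_commEquiv hsq hthin hfg) ha'e haa'

theorem exists_section (hπ : IsCovering T S π) (hδ : S.IsWeylDist M δ) (hM : M.IsRightAngled)
    (hsq : T.HasCommutingSquares M) (e₀ : E) :
    ∃ s : C → E, (∀ c, π (s c) = c) ∧ s (π e₀) = e₀ ∧
      ∀ i c d, S.rel i c d → T.rel i (s c) (s d) := by
  have hlift (c : C) : ∃ e, π e = c ∧ ∃ f, T.Joined f e e₀ := by
    obtain ⟨f, -, -, hf⟩ := hδ.exists_joined c (π e₀)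
    obtain ⟨e, he, hjoined⟩ := hπ.exists_joined_lift hf rfl
    exact ⟨e, he, f, hjoined⟩
  choose s hs f hf using hlift
  refine ⟨s, hs, hπ.eq_of_joined hδ hM hsq (hf _) (Joined.nil e₀) (hs _), fun i c d hcd => ?_⟩
  obtain ⟨b, hb, rfl⟩ := hπ.exists_lift (a := s c) ((hs c).symm ▸ hcd)
  obtain hbc | hbc := eq_or_ne b (s c)
  · rw [hbc, hs]
  · have hjoined : T.Joined (i :: f c) b e₀ := Joined.cons ⟨(T.rel i).symm hb, hbc⟩ (hf c)
    rwa [hπ.eq_of_joined hδ hM hsq (hf _) hjoined (hs _)]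

end IsCovering

namespace IsLegalColouring

variable {X : I → Type*} {lam : C → ∀ i, X i} (hlam : S.IsLegalColouring lam)
include hlam

theorem eq_of_rel {i : I} {c d : C} (h : S.rel i c d) (hcol : lam c i = lam d i) : c = d :=
  (hlam.bijOn i c).injOn ((S.rel i).refl c) h hcol

theorem colour_eq {i j : I} (hji : j ≠ i) {c d : C} (h : S.rel i c d) : lam d j = lam c j :=
  hlam.const i c j hji d h

theorem exists_rel_colour_eq (i : I) (c : C) (x : X i) : ∃ d, S.rel i c d ∧ lam d i = x :=
  (hlam.bijOn i c).surjOn (Set.mem_univ x)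

theorem exists_adj (i : I) [Nontrivial (X i)] (c : C) : ∃ d, S.Adj i c d := by
  obtain ⟨x, hx⟩ := exists_ne (lam c i)
  obtain ⟨d, hd, rfl⟩ := hlam.exists_rel_colour_eq i c x
  exact ⟨d, hd, fun h => hx (h ▸ rfl)⟩

theorem exists_colour_eq [Finite I] [Nonempty C] (x : ∀ i, X i) : ∃ c, lam c = x := by
  classical
  have := Fintype.ofFinite I
  suffices h : ∀ s : Finset I, ∃ c, ∀ i ∈ s, lam c i = x i by
    obtain ⟨c, hc⟩ := h Finset.univ
    exact ⟨c, funext fun i => hc i (Finset.mem_univ i)⟩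
  intro s
  induction s using Finset.induction_on with
  | empty => exact ⟨Classical.arbitrary C, fun i hi => absurd hi (Finset.notMem_empty i)⟩
  | insert j s _ ih =>
    obtain ⟨c, hc⟩ := ih
    obtain ⟨d, hcd, hd⟩ := hlam.exists_rel_colour_eq j c (x j)
    refine ⟨d, fun i hi => ?_⟩
    obtain rfl | hij := eq_or_ne i j
    · exact hd
    · rw [hlam.colour_eq hij hcd, hc i (Finset.mem_of_mem_insert_of_ne hi hij)]

end IsLegalColouring

theorem IsLegalColouring.isSemiregular {I : Type u} {C : Type v} {S : ChamberSystem I C}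
    {X : I → Type w} {lam : C → ∀ i, X i} (hlam : S.IsLegalColouring lam)
    [∀ i, Nontrivial (X i)] : S.IsSemiregular fun i => Cardinal.mk (X i) :=
  fun i => ⟨Cardinal.two_le_iff.2 (exists_pair_ne (X i)), fun c =>
    Cardinal.lift_mk_eq'.2 ⟨((hlam.bijOn i c).equiv _).trans (Equiv.Set.univ _)⟩⟩

section ExtendTypes

variable {p : I → Prop} {Y : Type*}

open Classical in
/-- Enlarge the set of types of a chamber system from `{i // p i}` to `I`, the panels of the new
types being single chambers. -/
noncomputable def extendTypes (T : ChamberSystem {i // p i} Y) : ChamberSystem I Y :=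
  ⟨fun i => if h : p i then T.rel ⟨i, h⟩ else ⊥⟩

variable {T : ChamberSystem {i // p i} Y}

theorem extendTypes_rel (i : {i // p i}) : T.extendTypes.rel i.1 = T.rel i :=
  dif_pos i.2

theorem extendTypes_rel_of_not {i : I} (hi : ¬ p i) : T.extendTypes.rel i = ⊥ :=
  dif_neg hi

theorem HasCommutingSquares.extendTypes (hT : T.HasCommutingSquares (M.induce p)) :
    T.extendTypes.HasCommutingSquares M := by
  intro i j hij a b c hi hj
  by_cases hpi : p i
  · by_cases hpj : p j
    · rw [extendTypes_rel ⟨i, hpi⟩] at hi ⊢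
      rw [extendTypes_rel ⟨j, hpj⟩] at hj ⊢
      exact hT (i := ⟨i, hpi⟩) (j := ⟨j, hpj⟩) hij hi hj
    · rw [extendTypes_rel_of_not hpj] at hj ⊢
      obtain rfl : b = c := hj
      exact ⟨a, rfl, hi⟩
  · rw [extendTypes_rel_of_not hpi] at hi ⊢
    obtain rfl : a = b := hi
    exact ⟨c, hj, rfl⟩

theorem IsLegalColouring.colour_eq_of_extendTypes {Q : {i // p i} → Type*} {μ : Y → ∀ i, Q i}
    (hμ : T.IsLegalColouring μ) {i : I} {j : {i // p i}} (hji : j.1 ≠ i) {y z : Y}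
    (h : T.extendTypes.rel i y z) : μ z j = μ y j := by
  by_cases hi : p i
  · rw [extendTypes_rel ⟨i, hi⟩] at h
    exact hμ.colour_eq (fun hj => hji (congrArg Subtype.val hj)) h
  · rw [extendTypes_rel_of_not hi] at h
    exact congrArg (μ · j) (show y = z from h).symm

end ExtendTypes

section FiberProduct

variable {Y : Type*}

/-- The product of two chamber systems over the same types, restricted to a set `R` of pairs of
chambers. -/
def fiberProduct (S : ChamberSystem I C) (T : ChamberSystem I Y) (R : Set (C × Y)) :
    ChamberSystem I R :=
  ⟨fun i => (S.rel i).comap (fun e => e.1.1) ⊓ (T.rel i).comap (fun e => e.1.2)⟩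

/-- The pairs of chambers whose colours match along the maps `g i`. -/
def colourMatching {p : I → Prop} {X : I → Type*} {Q : {i // p i} → Type*} (lam : C → ∀ i, X i)
    (μ : Y → ∀ i, Q i) (g : ∀ i : {i // p i}, X i.1 → Q i) : Set (C × Y) :=
  {e | ∀ i, μ e.2 i = g i (lam e.1 i.1)}

variable {p : I → Prop} {X : I → Type*} {Q : {i // p i} → Type*} {T : ChamberSystem {i // p i} Y}
  {lam : C → ∀ i, X i} {μ : Y → ∀ i, Q i}

theorem isCovering_fiberProduct (hlam : S.IsLegalColouring lam) (hμ : T.IsLegalColouring μ)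
    (g : ∀ i : {i // p i}, X i.1 → Q i) :
    IsCovering (S.fiberProduct T.extendTypes (colourMatching lam μ g)) S (fun e => e.1.1) where
  rel_map h := h.1
  exists_lift := by
    rintro i ⟨⟨c, y⟩, hcy⟩ d (hd : S.rel i c d)
    suffices ∃ z, T.extendTypes.rel i y z ∧ ∀ j, j.1 = i → μ z j = g j (lam d j.1) by
      obtain ⟨z, hz, hcol⟩ := this
      refine ⟨⟨(d, z), fun j => ?_⟩, ⟨hd, hz⟩, rfl⟩
      by_cases hji : j.1 = i
      · exact hcol j hji
      · exact (hμ.colour_eq_of_extendTypes hji hz).trans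
          ((hcy j).trans (congrArg (g j) (hlam.colour_eq hji hd).symm))
    by_cases hi : p i
    · obtain ⟨z, hz, hcol⟩ := hμ.exists_rel_colour_eq ⟨i, hi⟩ y (g ⟨i, hi⟩ (lam d i))
      rw [extendTypes_rel ⟨i, hi⟩]
      exact ⟨z, hz, fun j hj => by obtain rfl : j = ⟨i, hi⟩ := Subtype.ext hj; exact hcol⟩
    · exact ⟨y, (T.extendTypes.rel i).refl y, fun j hj => absurd j.2 (hj ▸ hi)⟩
  eq_of_map_eq := by
    rintro i ⟨⟨c, y⟩, hcy⟩ ⟨⟨d, z⟩, hdz⟩ ⟨-, hyz : T.extendTypes.rel i y z⟩ (rfl : c = d)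
    suffices y = z from Subtype.ext (Prod.ext rfl this)
    by_cases hi : p i
    · rw [extendTypes_rel ⟨i, hi⟩] at hyz
      exact hμ.eq_of_rel hyz ((hcy _).trans (hdz _).symm)
    · rwa [extendTypes_rel_of_not hi] at hyz

theorem hasCommutingSquares_fiberProduct (hlam : S.IsLegalColouring lam)
    (hμ : T.IsLegalColouring μ) (g : ∀ i : {i // p i}, X i.1 → Q i)
    (hS : S.HasCommutingSquares M) (hT : T.HasCommutingSquares (M.induce p)) :
    (S.fiberProduct T.extendTypes (colourMatching lam μ g)).HasCommutingSquares M := by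
  rintro i j hij ⟨⟨c₁, y₁⟩, h₁⟩ ⟨⟨c₂, y₂⟩, h₂⟩ ⟨⟨c₃, y₃⟩, h₃⟩ ⟨hci, hyi⟩ ⟨hcj, hyj⟩
  obtain ⟨c, hcj, hci⟩ := hS hij hci hcj
  obtain ⟨y, hyj, hyi⟩ := hT.extendTypes hij hyi hyj
  refine ⟨⟨(c, y), fun k => ?_⟩, ⟨hcj, hyj⟩, ⟨hci, hyi⟩⟩
  by_cases hkj : k.1 = j
  · have hki : k.1 ≠ i := hkj ▸ (ne_of_eq_two hij).symm
    exact (hμ.colour_eq_of_extendTypes hki hyi).symm.trans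
      ((h₃ k).trans (congrArg (g k) (hlam.colour_eq hki hci)))
  · exact (hμ.colour_eq_of_extendTypes hkj hyj).trans
      ((h₁ k).trans (congrArg (g k) (hlam.colour_eq hkj hcj).symm))

end FiberProduct

/-- A type collapse: a map of chamber systems which respects the panels of the types satisfying `p`
and contracts the panels of all other types. -/
structure IsTypeCollapse {p : I → Prop} {Y : Type*} (S : ChamberSystem I C)
    (T : ChamberSystem {i // p i} Y) (φ : C → Y) : Prop where
  rel_map : ∀ (i : {i // p i}) {c d}, S.rel i.1 c d → T.rel i (φ c) (φ d)
  map_eq : ∀ {i}, ¬ p i → ∀ {c d}, S.rel i c d → φ c = φ d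

namespace IsTypeCollapse

variable {p : I → Prop} {Y : Type*} {T : ChamberSystem {i // p i} Y} {φ : C → Y}

theorem eq_or_adj (hφ : IsTypeCollapse S T φ) {i : I} {c d : C} (h : S.rel i c d) :
    φ c = φ d ∨ ∃ hi : p i, T.Adj ⟨i, hi⟩ (φ c) (φ d) := by
  by_cases hi : p i
  · exact or_iff_not_imp_left.2 fun hne => ⟨hi, hφ.rel_map ⟨i, hi⟩ h, hne⟩
  · exact Or.inl (hφ.map_eq hi h)

theorem exists_joined (hφ : IsTypeCollapse S T φ) {f : List I} {c d : C} (h : S.Joined f c d) :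
    ∃ g : List {i // p i}, T.Joined g (φ c) (φ d) ∧ (g.map Subtype.val).Sublist f := by
  induction h with
  | nil c => exact ⟨[], Joined.nil _, List.Sublist.refl _⟩
  | cons hadj _ ih =>
    obtain ⟨g, hg, hsub⟩ := ih
    obtain heq | ⟨hi, hadj'⟩ := hφ.eq_or_adj hadj.1
    · exact ⟨g, heq ▸ hg, hsub.cons _⟩
    · exact ⟨⟨_, hi⟩ :: g, Joined.cons hadj' hg, hsub.cons_cons _⟩

theorem dist_le (hφ : IsTypeCollapse S T φ) {c d : C} (h : S.graph.Reachable c d) :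
    T.dist (φ c) (φ d) ≤ S.dist c d := by
  obtain ⟨γ, hγ⟩ := h.exists_walk_length_eq_dist
  have hadj (a b : C) (hab : S.graph.Adj a b) : φ a = φ b ∨ T.graph.Adj (φ a) (φ b) :=
    let ⟨_, hi⟩ := hab
    (hφ.eq_or_adj hi.1).imp_right fun ⟨_, h⟩ => ⟨_, h⟩
  obtain ⟨γ', hle⟩ := exists_walk_map_length_le hadj γ
  exact (SimpleGraph.dist_le γ').trans (hle.trans_eq hγ)

end IsTypeCollapse

section Collapse

variable {p : I → Prop} {Y : Type*} {T : ChamberSystem {i // p i} Y} {X : I → Type*}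
  {lam : C → ∀ i, X i} {δ : C → C → M.Group}

theorem exists_isTypeCollapse (hδ : S.IsWeylDist M δ) (hM : M.IsRightAngled)
    (hlam : S.IsLegalColouring lam) {Q : {i // p i} → Type*} {μ : Y → ∀ i, Q i}
    (hμ : T.IsLegalColouring μ) (hT : T.HasCommutingSquares (M.induce p))
    {g : ∀ i : {i // p i}, X i.1 → Q i} {c₀ : C} {y₀ : Y}
    (h₀ : ∀ i, μ y₀ i = g i (lam c₀ i.1)) :
    ∃ φ : C → Y, IsTypeCollapse S T φ ∧ φ c₀ = y₀ ∧ ∀ c i, μ (φ c) i = g i (lam c i.1) := by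
  have hsq := hasCommutingSquares_fiberProduct hlam hμ g (hδ.hasCommutingSquares hM) hT
  obtain ⟨s, hs, hs₀, hrel⟩ :=
    (isCovering_fiberProduct hlam hμ g).exists_section hδ hM hsq ⟨(c₀, y₀), h₀⟩
  refine ⟨fun c => (s c).1.2, ⟨fun i c d h => ?_, fun hi c d h => ?_⟩, ?_, fun c i => ?_⟩
  · rw [← extendTypes_rel i]
    exact (hrel i.1 c d h).2
  · have hbot := (hrel _ c d h).2
    rwa [extendTypes_rel_of_not hi] at hbot
  · exact congrArg (fun e => e.1.2) hs₀
  · rw [(s c).2 i, hs c]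

/-- The chamber system on `D` pulled back along `ι : D → C`, with only the types satisfying `p`. -/
def comap {D : Type*} (S : ChamberSystem I C) (p : I → Prop) (ι : D → C) :
    ChamberSystem {i // p i} D :=
  ⟨fun i => (S.rel i.1).comap ι⟩

theorem Joined.of_comap {D : Type*} {ι : D → C} (hι : Function.Injective ι)
    {f : List {i // p i}} {c d : D} (h : (S.comap p ι).Joined f c d) :
    S.Joined (f.map Subtype.val) (ι c) (ι d) := by
  induction h with
  | nil c => exact Joined.nil _
  | cons h _ ih => exact Joined.cons ⟨h.1, hι.ne h.2⟩ ih

theorem IsWeylDist.exists_joined_comap (hδ : S.IsWeylDist M δ) {D : Type*} {ι : D → C}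
    {φ : C → D} (hφ : IsTypeCollapse S (S.comap p ι) φ) (hι : Function.LeftInverse φ ι) {f : List I}
    (hf : M.toCoxeterSystem.IsReduced f) {c d : D}
    (h : δ (ι c) (ι d) = M.toCoxeterSystem.wordProd f) :
    ∃ g : List {i // p i}, g.map Subtype.val = f ∧ (S.comap p ι).Joined g c d := by
  -- The collapse may only delete letters of `f`, and it deletes none since `f` is reduced.
  obtain ⟨g, hg, hsub⟩ := hφ.exists_joined ((hδ f hf _ _).1 h)
  rw [hι, hι] at hg
  have hlen := hδ.length_le (hg.of_comap hι.injective)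
  rw [h, hf.eq] at hlen
  exact ⟨g, hsub.eq_of_length_le hlen, hg⟩

theorem IsWeylDist.comap (hδ : S.IsWeylDist M δ) (hM : M.IsRightAngled) {D : Type*} {ι : D → C}
    {φ : C → D} (hφ : IsTypeCollapse S (S.comap p ι) φ) (hι : Function.LeftInverse φ ι) :
    (S.comap p ι).IsWeylDist (M.induce p)
      fun c d => parabolicRetraction hM p (δ (ι c) (ι d)) := by
  intro f hf c d
  change parabolicRetraction hM p (δ (ι c) (ι d)) = _ ↔ _
  have hred := isReduced_map_val hM hf
  refine ⟨fun h => ?_, fun h => ?_⟩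
  · obtain ⟨f', hf', hcd, -⟩ := hδ.exists_joined (ι c) (ι d)
    obtain ⟨g, rfl, -⟩ := hδ.exists_joined_comap hφ hι hf' hcd
    rw [hcd, parabolicRetraction_wordProd_map_val] at h
    rw [wordProd_map_val, h, ← wordProd_map_val] at hcd
    obtain ⟨g', hg', hjoined⟩ := hδ.exists_joined_comap hφ hι hred hcd
    rwa [Subtype.val_injective.list_map hg'] at hjoined
  · rw [(hδ _ hred _ _).2 (h.of_comap hι.injective), parabolicRetraction_wordProd_map_val]

theorem IsTypeCollapse.idempotent (hδ : S.IsWeylDist M δ) (hlam : S.IsLegalColouring lam)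
    {φ : C → C} (hφ : IsTypeCollapse S (S.comap p id) φ) {c₀ : C} (h₀ : φ c₀ = c₀)
    (hcol : ∀ c (i : {i // p i}), lam (φ (φ c)) i.1 = lam (φ c) i.1) (c : C) :
    φ (φ c) = φ c := by
  refine hδ.induction_on (P := fun c => φ (φ c) = φ c) (congrArg φ h₀) (fun i c d h ih => ?_) c
  by_cases hi : p i
  · have hrel : S.rel i (φ c) (φ d) := hφ.rel_map ⟨i, hi⟩ h
    have hrel' : S.rel i (φ (φ c)) (φ (φ d)) := hφ.rel_map ⟨i, hi⟩ hrel
    rw [ih] at hrel'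
    exact hlam.eq_of_rel ((S.rel i).trans ((S.rel i).symm hrel') hrel) (hcol d ⟨i, hi⟩)
  · rwa [← hφ.map_eq hi h]

theorem exists_retraction (hδ : S.IsWeylDist M δ) (hM : M.IsRightAngled)
    (hlam : S.IsLegalColouring lam) {g : ∀ i : {i // p i}, X i.1 → X i.1}
    (hg : ∀ i x, g i (g i x) = g i x) {c₀ : C} (h₀ : ∀ i, g i (lam c₀ i.1) = lam c₀ i.1) :
    ∃ φ : C → C, IsTypeCollapse S (S.comap p id) φ ∧ φ c₀ = c₀ ∧ (∀ c, φ (φ c) = φ c) ∧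
      ∀ c i, lam (φ c) i.1 = g i (lam c i.1) := by
  have hμ : (S.comap p id).IsLegalColouring fun c i => lam c i.1 :=
    ⟨fun i => hlam.bijOn i.1, fun i c j hji => hlam.const i.1 c j.1 (Subtype.coe_ne_coe.2 hji)⟩
  obtain ⟨φ, hφ, hφ₀, hcol⟩ := exists_isTypeCollapse hδ hM hlam hμ
    (fun i j hij => hδ.hasCommutingSquares hM (i := i.1) (j := j.1) hij) fun i => (h₀ i).symm
  refine ⟨φ, hφ, hφ₀, hφ.idempotent hδ hlam hφ₀ fun c i => ?_, hcol⟩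
  rw [hcol, hcol, hg]

theorem IsTypeCollapse.isLegalColouring_fixedPoints (hlam : S.IsLegalColouring lam) {φ : C → C}
    (hφ : IsTypeCollapse S (S.comap p id) φ) {Z : {i // p i} → Type*}
    {k : ∀ i : {i // p i}, X i.1 → Z i} {σ : ∀ i, Z i → X i.1}
    (hσ : ∀ i, Function.RightInverse (σ i) (k i))
    (hcol : ∀ c i, lam (φ c) i.1 = σ i (k i (lam c i.1))) :
    (S.comap p (Subtype.val : Function.fixedPoints φ → C)).IsLegalColouring
      fun c i => k i (lam c.1 i.1) := by
  refine ⟨fun i c => ⟨fun _ _ => Set.mem_univ _, fun a ha b hb hab => ?_, fun z _ => ?_⟩,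
    fun i c j hji d hd => ?_⟩
  · have hfix (e : Function.fixedPoints φ) : σ i (k i (lam e.1 i.1)) = lam e.1 i.1 := by
      rw [← hcol, e.2.eq]
    refine Subtype.ext (hlam.eq_of_rel ((S.rel i.1).trans ((S.rel i.1).symm ha) hb) ?_)
    rw [← hfix a, ← hfix b]
    exact congrArg (σ i) hab
  · obtain ⟨d, hd, hdz⟩ := hlam.exists_rel_colour_eq i.1 c.1 (σ i z)
    have hrel : S.rel i.1 (φ c.1) (φ d) := hφ.rel_map i hd
    rw [c.2.eq] at hrel
    have hfix : φ d = d := by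
      refine hlam.eq_of_rel ((S.rel i.1).trans ((S.rel i.1).symm hrel) hd) ?_
      rw [hcol, hdz, hσ i]
    exact ⟨⟨d, hfix⟩, hd, (congrArg (k i) hdz).trans (hσ i z)⟩
  · exact congrArg (k j) (hlam.colour_eq (Subtype.coe_ne_coe.2 hji) hd)

end Collapse

theorem IsBuilding.exists_implosion {I : Type u} {C : Type v} {M : CoxeterMatrix I}
    {S : ChamberSystem I C} (hS : S.IsBuilding M) (hM : M.IsRightAngled) {X : I → Type*}
    {lam : C → ∀ i, X i} (hlam : S.IsLegalColouring lam) {p : I → Prop} {Z : {i // p i} → Type w}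
    [∀ i, Nontrivial (Z i)] {k : ∀ i : {i // p i}, X i.1 → Z i}
    (hk : ∀ i, Function.Surjective (k i)) :
    ∃ (C' : Type v) (S' : ChamberSystem {i // p i} C') (lam' : C' → ∀ i, Z i),
      S'.IsSemiregularRAB (M.induce p) (fun i => Cardinal.mk (Z i)) ∧
        S'.IsLegalColouring lam' := by
  obtain ⟨⟨c₀⟩, -, δ, hδ : S.IsWeylDist M δ⟩ := hS
  choose σ hσ hσ₀ using fun i => exists_rightInverse_apply_eq (hk i) (lam c₀ i.1)
  obtain ⟨φ, hφ, hφ₀, hidem, hcol⟩ := exists_retraction hδ hM hlam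
    (g := fun i x => σ i (k i x)) (fun i x => congrArg (σ i) (hσ i _)) hσ₀
  have hlegal := hφ.isLegalColouring_fixedPoints hlam hσ hcol
  let ψ : C → Function.fixedPoints φ := fun c => ⟨φ c, hidem c⟩
  have hψ : IsTypeCollapse S (S.comap p Subtype.val) ψ :=
    ⟨hφ.rel_map, fun hi _ _ h => Subtype.ext (hφ.map_eq hi h)⟩
  have hδ' := hδ.comap hM hψ fun c => Subtype.ext c.2
  exact ⟨_, _, _, ⟨isRightAngled_induce hM p,
    ⟨⟨⟨c₀, hφ₀⟩⟩, fun i c => hlegal.exists_adj i c, _, hδ'⟩, hlegal.isSemiregular⟩, hlegal⟩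

theorem IsBuilding.exists_implosion_map {I C C' : Type*} {M : CoxeterMatrix I}
    {S : ChamberSystem I C} (hS : S.IsBuilding M) (hM : M.IsRightAngled) {X : I → Type*}
    {lam : C → ∀ i, X i} (hlam : S.IsLegalColouring lam) {p : I → Prop} [Finite {i // p i}]
    {Z : {i // p i} → Type*} {k : ∀ i : {i // p i}, X i.1 → Z i}
    (hk : ∀ i, Function.Surjective (k i)) {S' : ChamberSystem {i // p i} C'}
    {lam' : C' → ∀ i, Z i} (hS' : S'.IsBuilding (M.induce p)) (hlam' : S'.IsLegalColouring lam') :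
    ∃ τ : C → C', Function.Surjective τ ∧ (∀ c i, lam' (τ c) i = k i (lam c i.1)) ∧
      ∀ c₁ c₂, S'.dist (τ c₁) (τ c₂) ≤ S.dist c₁ c₂ := by
  obtain ⟨⟨c₀⟩, -, δ, hδ : S.IsWeylDist M δ⟩ := hS
  obtain ⟨_, -, δ', hδ' : S'.IsWeylDist (M.induce p) δ'⟩ := hS'
  obtain ⟨y₀, hy₀⟩ := hlam'.exists_colour_eq fun i => k i (lam c₀ i.1)
  obtain ⟨τ, hτ, hτ₀, hcol⟩ := exists_isTypeCollapse hδ hM hlam hlam'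
    (hδ'.hasCommutingSquares (isRightAngled_induce hM p)) (congrFun hy₀)
  refine ⟨τ, hδ'.induction_on ⟨c₀, hτ₀⟩ ?_, hcol, fun c d => hτ.dist_le (hδ.reachable c d)⟩
  rintro i _ y hy ⟨c, rfl⟩
  obtain ⟨x, hx⟩ := hk i (lam' y i)
  obtain ⟨d, hd, rfl⟩ := hlam.exists_rel_colour_eq i.1 c x
  have hrel : S'.rel i (τ d) y := (S'.rel i).trans ((S'.rel i).symm (hτ.rel_map i hd)) hy
  exact ⟨d, hlam'.eq_of_rel hrel ((hcol d i).trans hx)⟩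

end ChamberSystem

theorem mainTheorem9_general {I : Type u} {C : Type v} (M : CoxeterMatrix I)
    (hM : M.IsRightAngled) (S : ChamberSystem I C) (hS : S.IsBuilding M) (X : I → Type w)
    (lam : C → ∀ i, X i) (hlam : S.IsLegalColouring lam) (p : I → Prop) [Finite {i // p i}]
    (Z : {i // p i} → Type*) [∀ i, Nontrivial (Z i)] (k : ∀ i : {i // p i}, X i.1 → Z i)
    (hk : ∀ i, Function.Surjective (k i)) :
    (∃ (C' : Type v) (S' : ChamberSystem {i // p i} C') (lam' : C' → ∀ i, Z i),
      S'.IsSemiregularRAB (M.induce p) (fun i => Cardinal.mk (Z i)) ∧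
      S'.IsLegalColouring lam') ∧
    ∀ (C' : Type v') (S' : ChamberSystem {i // p i} C') (lam' : C' → ∀ i, Z i),
      S'.IsBuilding (M.induce p) → S'.IsLegalColouring lam' →
      ∃ τ : C → C', Function.Surjective τ ∧
        (∀ (c : C) (i : {i // p i}), lam' (τ c) i = k i (lam c i.1)) ∧
        ∀ c₁ c₂ : C, S'.dist (τ c₁) (τ c₂) ≤ S.dist c₁ c₂ :=
  ⟨hS.exists_implosion hM hlam hk,
    fun _ _ _ hS' hlam' => hS.exists_implosion_map hM hlam hk hS' hlam'⟩

theorem mainTheorem9 {I : Type u} [Finite I] {C : Type v}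
    (M : CoxeterMatrix I) (S : ChamberSystem I C) (X : I → Type w)
    (hS : S.IsSemiregularRAB M fun i => Cardinal.mk (X i))
    (lam : C → ∀ i, X i) (hlam : S.IsLegalColouring lam)
    (r : ∀ i, Setoid (X i)) :
    (∃ (C' : Type v) (S' : ChamberSystem {i // r i ≠ ⊤} C')
        (lam' : C' → ∀ i : {i // r i ≠ ⊤}, Quotient (r i.1)),
      S'.IsSemiregularRAB (M.induce fun i => r i ≠ ⊤)
        (fun i => Cardinal.mk (Quotient (r i.1))) ∧
      S'.IsLegalColouring lam') ∧
    ∀ (C' : Type v') (S' : ChamberSystem {i // r i ≠ ⊤} C')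
      (lam' : C' → ∀ i : {i // r i ≠ ⊤}, Quotient (r i.1)),
      S'.IsSemiregularRAB (M.induce fun i => r i ≠ ⊤)
        (fun i => Cardinal.mk (Quotient (r i.1))) →
      S'.IsLegalColouring lam' →
      ∃ τ : C → C', Function.Surjective τ ∧
        (∀ (c : C) (i : {i // r i ≠ ⊤}), lam' (τ c) i = Quotient.mk (r i.1) (lam c i.1)) ∧
        ∀ c₁ c₂ : C, S'.dist (τ c₁) (τ c₂) ≤ S.dist c₁ c₂ := by
  have (i : {i // r i ≠ ⊤}) : Nontrivial (Quotient (r i.1)) :=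
    not_subsingleton_iff_nontrivial.1 (mt Quotient.subsingleton_iff.1 i.2)
  obtain ⟨hex, hmap⟩ := mainTheorem9_general M hS.rightAngled S hS.building X lam hlam (r · ≠ ⊤)
    (fun i => Quotient (r i.1)) (fun i => Quotient.mk (r i.1)) fun _ => Quotient.mk_surjective
  exact ⟨hex, fun C' S' lam' hS' => hmap C' S' lam' hS'.building⟩
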